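/- Let $X$ be the graph with vertex set $\mathbb{Z}^2$ in which two vertices $(x,y)$ and $(x',y')$ are joined by an edge if and only if $|x-x'|+|y-y'|=1$. For $A\subset\mathbb{Z}^2$, let $\partial A$ be the set of vertices of $\mathbb{Z}^2\setminus A$ that are adjacent in $X$ to some vertex of $A$. A nonempty finite set $A\subset\mathbb{Z}^2$ is called \emph{minimal} if $|\partial A|\le|\partial B|$ for every $B\subset\mathbb{Z}^2$ with $|B|=|A|$. Two sets $A,B\subset\mathbb{Z}^2$ are \emph{congruent} if $\phi(A)=B$ for some graph automorphism $\phi$ of $X$. Let $\mathcal{G}$ be the graph whose vertices are the congruence classes of minimal sets, where two vertices $v$ and $w$ are joined by an edge if and only if there are minimal sets $A\in v$ and $B\in w$ whose symmetric difference has exactly one element. Then $\mathcal{G}$ has exactly one infinite connected component, that is, exactly one connected component with infinitely many vertices. -/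

import Mathlib

namespace MinimalSets

/-- The planar integer lattice `X`: vertex set `ℤ × ℤ`, with edges joining the pairs of vertices
at `ℓ₁`-distance one. -/
def lattice : SimpleGraph (ℤ × ℤ) where
  Adj p q := |p.1 - q.1| + |p.2 - q.2| = 1
  symm := ⟨by
    intro p q h
    rwa [abs_sub_comm q.1 p.1, abs_sub_comm q.2 p.2]⟩
  loopless := ⟨by
    intro p h
    simp at h⟩

/-- The vertex boundary of a set `A` of vertices of a graph: the vertices outside `A` that are
adjacent to some vertex of `A`. -/
def vertexBoundary {V : Type*} (X : SimpleGraph V) (A : Set V) : Set V :=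
  {u | u ∉ A ∧ ∃ v ∈ A, X.Adj u v}

/-- A minimal set of vertices of `X`: a nonempty finite set whose vertex boundary has the least
size among the vertex boundaries of all sets with the same number of vertices. -/
structure IsMinimal {V : Type*} (X : SimpleGraph V) (A : Set V) : Prop where
  nonempty : A.Nonempty
  finite : A.Finite
  boundary_le : ∀ B : Set V, B.encard = A.encard →
    (vertexBoundary X A).encard ≤ (vertexBoundary X B).encard

/-- Two sets of vertices are congruent if a graph automorphism carries one onto the other. -/
def Congruent {V : Type*} (X : SimpleGraph V) (A B : Set V) : Prop :=
  ∃ φ : X ≃g X, φ '' A = B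

theorem Congruent.encard_eq {V : Type*} {X : SimpleGraph V} {A B : Set V}
    (h : Congruent X A B) : A.encard = B.encard := by
  obtain ⟨φ, rfl⟩ := h
  exact (φ.injective.encard_image A).symm

/-- Congruence, as an equivalence relation on the minimal sets of `X`. -/
def congruence {V : Type*} (X : SimpleGraph V) : Setoid {A : Set V // IsMinimal X A} where
  r A B := Congruent X A.1 B.1
  iseqv := by
    refine ⟨fun A => ⟨SimpleGraph.Iso.refl, ?_⟩, ?_, ?_⟩
    · exact Set.image_id A.1
    · rintro ⟨A, hA⟩ ⟨B, hB⟩ ⟨φ, hφ⟩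
      refine ⟨φ.symm, ?_⟩
      change φ '' A = B at hφ
      change φ.symm '' B = A
      rw [← hφ, Set.image_image]
      simp
    · rintro ⟨A, hA⟩ ⟨B, hB⟩ ⟨C, hC⟩ ⟨φ, hφ⟩ ⟨ψ, hψ⟩
      refine ⟨φ.trans ψ, ?_⟩
      change φ '' A = B at hφ
      change ψ '' B = C at hψ
      change (φ.trans ψ) '' A = C
      rw [← hψ, ← hφ, Set.image_image]
      rfl

/-- Congruence classes of minimal sets of `X`. -/
abbrev MinimalClass {V : Type*} (X : SimpleGraph V) : Type _ := Quotient (congruence X)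

theorem encard_symmDiff_ne_one {V : Type*} {A B : Set V} (hA : A.Finite) (hB : B.Finite)
    (h : A.encard = B.encard) : (symmDiff A B).encard ≠ 1 := by
  intro h1
  have e1 := Set.encard_sdiff_add_encard_inter A B
  have e2 := Set.encard_sdiff_add_encard_inter B A
  have e3 : (symmDiff A B).encard = (A \ B).encard + (B \ A).encard :=
    Set.encard_union_eq disjoint_sdiff_sdiff
  rw [Set.inter_comm B A] at e2
  rw [e3] at h1
  have f1 : (A \ B).encard = ((A \ B).ncard : ℕ∞) := (hA.sdiff.cast_ncard_eq).symm
  have f2 : (B \ A).encard = ((B \ A).ncard : ℕ∞) := (hB.sdiff.cast_ncard_eq).symm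
  have f3 : (A ∩ B).encard = ((A ∩ B).ncard : ℕ∞) := ((hA.inter_of_left B).cast_ncard_eq).symm
  rw [← e1, ← e2, f1, f2, f3] at h
  rw [f1, f2] at h1
  norm_cast at h h1
  omega

/-- The graph `𝒢` of minimal sets of `X`: its vertices are the congruence classes of minimal sets,
and two classes are adjacent if they have representatives whose symmetric difference has exactly
one element. -/
def minimalGraph {V : Type*} (X : SimpleGraph V) : SimpleGraph (MinimalClass X) where
  Adj v w := ∃ A B : {A : Set V // IsMinimal X A},
    Quotient.mk (congruence X) A = v ∧ Quotient.mk (congruence X) B = w ∧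
      (symmDiff A.1 B.1).encard = 1
  symm := ⟨by
    rintro v w ⟨A, B, hA, hB, h⟩
    exact ⟨B, A, hB, hA, by rwa [symmDiff_comm]⟩⟩
  loopless := ⟨by
    rintro v ⟨A, B, hA, hB, h⟩
    have hAB : Congruent X A.1 B.1 := Quotient.exact (hA.trans hB.symm)
    exact encard_symmDiff_ne_one A.2.finite B.2.finite hAB.encard_eq h⟩

end MinimalSets

/-! Adjacent classes differ in size by one and only finitely many classes have a given size
(`finite_classSize_le`), so an infinite component contains a class of every sufficiently large size
(`eventually_exists_mem_supp`). For the size 2r² + 2r + 1 of an ℓ₁-ball with r ≥ 1 there is just one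
class (`eq_of_classSize_eq_ball`), so any two infinite components meet. An infinite component exists
because a pair of neighbours grows, one point at a time and up to congruence, through minimal sets
into arbitrarily large diagonal boxes (`reachableBox_self`).

Both uniqueness and minimality rest on the inequality 8|A| ≤ (|∂A| - 2)² + 4 (`isoperimetric`). Let
E and O be the parts of A with x + y even and odd, and N(E) the set of neighbours of E. Then ∂A is
the disjoint union of N(E) \ O and N(O) \ E. In the coordinates x + y and x - y, passing to
neighbours adds {-1, 1} × {-1, 1}. Hence for nonempty E, |N(E)| ≥ |E| + s + 1, where s counts the
values of x + y plus those of x - y on E, and 4|E| ≤ s². With t defined likewise for O, |∂A| ≥ s + t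
+ 2. When |s - t| ≤ 2, the inequality follows from 8|A| ≤ 2(s² + t²) = (s + t)² + (s - t)². Equality
for |A| ≥ 2 forces one part to be a diagonal square and the other its neighbourhood, so A is a ball
(`exists_eq_ball`). -/

namespace MinimalSets

/-! ### Neighbourhoods of finite sets in diagonal coordinates -/

/-- The vertices of the lattice adjacent to some vertex of `A`. -/
def nbr (A : Finset (ℤ × ℤ)) : Finset (ℤ × ℤ) :=
  A.biUnion fun p => {(p.1 + 1, p.2), (p.1 - 1, p.2), (p.1, p.2 + 1), (p.1, p.2 - 1)}

/-- The vertex boundary of a finite set, as a finite set. -/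
def bd (A : Finset (ℤ × ℤ)) : Finset (ℤ × ℤ) := nbr A \ A

theorem lattice_adj_iff (p q : ℤ × ℤ) : lattice.Adj p q ↔
    (p.1 + p.2 = q.1 + q.2 + 1 ∨ p.1 + p.2 = q.1 + q.2 - 1) ∧
      (p.1 - p.2 = q.1 - q.2 + 1 ∨ p.1 - p.2 = q.1 - q.2 - 1) := by
  change |p.1 - q.1| + |p.2 - q.2| = 1 ↔ _
  rcases abs_cases (p.1 - q.1) with h | h <;> rcases abs_cases (p.2 - q.2) with h' | h' <;> omega

theorem mem_nbr {A : Finset (ℤ × ℤ)} {p : ℤ × ℤ} : p ∈ nbr A ↔ ∃ q ∈ A, lattice.Adj p q := by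
  simp only [nbr, Finset.mem_biUnion, Finset.mem_insert, Finset.mem_singleton]
  refine exists_congr fun q => and_congr_right fun _ => ?_
  rw [lattice_adj_iff]
  obtain ⟨a, b⟩ := p
  obtain ⟨c, d⟩ := q
  simp only [Prod.mk.injEq]
  omega

theorem coe_bd (A : Finset (ℤ × ℤ)) : (bd A : Set (ℤ × ℤ)) = vertexBoundary lattice ↑A := by
  ext p
  simp only [bd, vertexBoundary, Finset.coe_sdiff, Set.mem_sdiff, Finset.mem_coe, mem_nbr,
    Set.mem_ofPred_eq]
  tauto

/-- The change of coordinates `(x, y) ↦ (x + y, x - y)`. -/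
def diag (p : ℤ × ℤ) : ℤ × ℤ := (p.1 + p.2, p.1 - p.2)

theorem diag_injective : Function.Injective diag := by
  rintro ⟨a, b⟩ ⟨c, d⟩ h
  simp only [diag, Prod.mk.injEq] at h ⊢
  omega

/-- The sumset of a finite set of integers with `{-1, 1}`. -/
def spread (S : Finset ℤ) : Finset ℤ := S.image (· + 1) ∪ S.image (· - 1)

theorem mem_spread {S : Finset ℤ} {x : ℤ} : x ∈ spread S ↔ ∃ y ∈ S, x = y + 1 ∨ x = y - 1 := by
  simp only [spread, Finset.mem_union, Finset.mem_image]
  constructor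
  · rintro (⟨y, hy, rfl⟩ | ⟨y, hy, rfl⟩)
    exacts [⟨y, hy, .inl rfl⟩, ⟨y, hy, .inr rfl⟩]
  · rintro ⟨y, hy, rfl | rfl⟩
    exacts [.inl ⟨y, hy, rfl⟩, .inr ⟨y, hy, rfl⟩]

/-- The sumset of a finite set of pairs of integers with `{(-1, 0), (1, 0)}`. -/
def spreadFst (Y : Finset (ℤ × ℤ)) : Finset (ℤ × ℤ) :=
  Y.image (fun p => (p.1 + 1, p.2)) ∪ Y.image (fun p => (p.1 - 1, p.2))

/-- The sumset of a finite set of pairs of integers with `{(0, -1), (0, 1)}`. -/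
def spreadSnd (Y : Finset (ℤ × ℤ)) : Finset (ℤ × ℤ) :=
  (spreadFst (Y.image Prod.swap)).image Prod.swap

theorem mem_spreadFst {Y : Finset (ℤ × ℤ)} {p : ℤ × ℤ} :
    p ∈ spreadFst Y ↔ ∃ q ∈ Y, (p.1 = q.1 + 1 ∨ p.1 = q.1 - 1) ∧ p.2 = q.2 := by
  simp only [spreadFst, Finset.mem_union, Finset.mem_image, ← exists_or, ← and_or_left]
  refine exists_congr fun q => and_congr_right fun _ => ?_
  simp only [Prod.ext_iff]
  grind

theorem mem_spreadSnd {Y : Finset (ℤ × ℤ)} {p : ℤ × ℤ} :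
    p ∈ spreadSnd Y ↔ ∃ q ∈ Y, (p.2 = q.2 + 1 ∨ p.2 = q.2 - 1) ∧ p.1 = q.1 := by
  simp only [spreadSnd, Finset.mem_image, mem_spreadFst]
  constructor
  · rintro ⟨_, ⟨_, ⟨q, hq, rfl⟩, h⟩, rfl⟩
    exact ⟨q, hq, h⟩
  · rintro ⟨q, hq, h⟩
    exact ⟨p.swap, ⟨q.swap, ⟨q, hq, rfl⟩, h⟩, Prod.swap_swap p⟩

/-- The four lattice steps become (±1, ±1) in diagonal coordinates, a product set, so the
neighbourhood is obtained by two one-dimensional sumsets. -/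
theorem image_diag_nbr (X : Finset (ℤ × ℤ)) :
    (nbr X).image diag = spreadSnd (spreadFst (X.image diag)) := by
  ext ⟨a, b⟩
  simp only [Finset.mem_image, mem_nbr, mem_spreadSnd, mem_spreadFst, lattice_adj_iff]
  constructor
  · rintro ⟨p, ⟨q, hq, h1, h2⟩, h⟩
    simp only [diag, Prod.mk.injEq] at h
    refine ⟨(a, q.1 - q.2), ⟨diag q, ⟨q, hq, rfl⟩, ?_, rfl⟩, ?_, rfl⟩ <;> simp only [diag] <;> omega
  · rintro ⟨c, ⟨_, ⟨q, hq, rfl⟩, h1, h2⟩, h3, h4⟩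
    simp only [diag] at *
    -- The halves are exact: `a` and `b` each differ by one from the coordinates of `diag q`, which
    -- have equal parity.
    refine ⟨((a + b) / 2, (a - b) / 2), ⟨q, hq, ?_, ?_⟩, ?_⟩
    · dsimp only; omega
    · dsimp only; omega
    · simp only [Prod.mk.injEq]; omega

/-- The left shift of `Y` has as many points as `Y`, and in each nonempty row the right shift of the
last point (these last points form `T`) is new. -/
theorem card_add_card_le_card_spreadFst (Y : Finset (ℤ × ℤ)) :
    Y.card + (Y.image Prod.snd).card ≤ (spreadFst Y).card := by
  set T := Y.filter fun p => ∀ q ∈ Y, q.2 = p.2 → q.1 ≤ p.1 with hT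
  have hrows : Y.image Prod.snd ⊆ T.image Prod.snd := by
    intro v hv
    obtain ⟨q, hq, rfl⟩ := Finset.mem_image.1 hv
    obtain ⟨m, hm, hmax⟩ := (Y.filter fun p => p.2 = q.2).exists_max_image Prod.fst
      ⟨q, by simp [hq]⟩
    rw [Finset.mem_filter] at hm
    refine Finset.mem_image.2 ⟨m, Finset.mem_filter.2 ⟨hm.1, fun x hx hxm => ?_⟩, hm.2⟩
    exact hmax x (Finset.mem_filter.2 ⟨hx, hxm.trans hm.2⟩)
  have h1 : (Y.image Prod.snd).card ≤ (T.image fun p => (p.1 + 1, p.2)).card := by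
    rw [Finset.card_image_of_injective T (f := fun p : ℤ × ℤ => (p.1 + 1, p.2))
      (by rintro ⟨a, b⟩ ⟨c, d⟩ h; simpa using h)]
    exact (Finset.card_le_card hrows).trans Finset.card_image_le
  have h2 : (Y.image fun p => (p.1 - 1, p.2)).card = Y.card :=
    Finset.card_image_of_injective _ (by rintro ⟨a, b⟩ ⟨c, d⟩ h; simpa using h)
  have hdisj : Disjoint (Y.image fun p => (p.1 - 1, p.2)) (T.image fun p => (p.1 + 1, p.2)) := by
    rw [Finset.disjoint_left]
    intro x hx hx'
    obtain ⟨p, hp, rfl⟩ := Finset.mem_image.1 hx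
    obtain ⟨q, hq, hqp⟩ := Finset.mem_image.1 hx'
    rw [Finset.mem_filter] at hq
    simp only [Prod.mk.injEq] at hqp
    have := hq.2 p hp hqp.2.symm
    omega
  have h3 : (Y.image fun p => (p.1 - 1, p.2)) ∪ (T.image fun p => (p.1 + 1, p.2)) ⊆
      spreadFst Y := by
    rw [spreadFst, Finset.union_comm]
    exact Finset.union_subset_union (Finset.image_subset_image (Finset.filter_subset _ _)) le_rfl
  have h4 := Finset.card_le_card h3
  rw [Finset.card_union_of_disjoint hdisj] at h4
  omega

theorem card_add_card_le_card_spreadSnd (Y : Finset (ℤ × ℤ)) :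
    Y.card + (Y.image Prod.fst).card ≤ (spreadSnd Y).card := by
  have h := card_add_card_le_card_spreadFst (Y.image Prod.swap)
  rw [Finset.image_image, Finset.card_image_of_injective _ Prod.swap_injective] at h
  rw [spreadSnd, Finset.card_image_of_injective _ Prod.swap_injective]
  exact h

theorem image_fst_spreadFst (Y : Finset (ℤ × ℤ)) :
    (spreadFst Y).image Prod.fst = spread (Y.image Prod.fst) := by
  rw [spreadFst, spread, Finset.image_union]
  simp only [Finset.image_image]
  rfl

theorem card_lt_card_spread {S : Finset ℤ} (hS : S.Nonempty) : S.card < (spread S).card := by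
  have h2 : (S.image (· - 1)).card = S.card :=
    Finset.card_image_of_injective _ (sub_left_injective)
  rw [← h2]
  refine Finset.card_lt_card (Finset.ssubset_iff_of_subset Finset.subset_union_right |>.2
    ⟨S.max' hS + 1, mem_spread.2 ⟨_, S.max'_mem hS, .inl rfl⟩, fun h => ?_⟩)
  obtain ⟨y, hy, h⟩ := Finset.mem_image.1 h
  have := S.le_max' y hy
  omega

/-- A finite set of integers for which `S + {-1, 1}` is as small as possible is an arithmetic
progression of difference two. -/
theorem exists_eq_progression {S : Finset ℤ} (hS : S.Nonempty)
    (h : (spread S).card = S.card + 1) :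
    ∃ a : ℤ, ∀ x, x ∈ S ↔ ∃ i : ℕ, i < S.card ∧ x = a + 2 * i := by
  have h2 : (S.image (· - 1)).card = S.card :=
    Finset.card_image_of_injective _ (sub_left_injective)
  -- Otherwise `x + 1` and `S.max' hS + 1` are two distinct elements of `spread S` outside the left
  -- shift of `S`, one too many.
  have hstep : ∀ x ∈ S, x ≠ S.max' hS → x + 2 ∈ S := by
    intro x hx hne
    by_contra hx2
    have hsub : insert (x + 1) (insert (S.max' hS + 1) (S.image (· - 1))) ⊆ spread S := by
      intro y hy
      rw [Finset.mem_insert, Finset.mem_insert] at hy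
      rcases hy with rfl | rfl | hy
      · exact mem_spread.2 ⟨_, hx, .inl rfl⟩
      · exact mem_spread.2 ⟨_, S.max'_mem hS, .inl rfl⟩
      · exact Finset.subset_union_right hy
    have hcard := Finset.card_le_card hsub
    rw [Finset.card_insert_of_notMem, Finset.card_insert_of_notMem] at hcard
    · omega
    · intro hm
      obtain ⟨y, hy, hyx⟩ := Finset.mem_image.1 hm
      have := S.le_max' y hy
      omega
    · intro hm
      rw [Finset.mem_insert] at hm
      rcases hm with hm | hm
      · omega
      · obtain ⟨y, hy, hyx⟩ := Finset.mem_image.1 hm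
        exact hx2 (by rwa [show x + 2 = y by omega])
  have hup : ∀ x ∈ S, ∀ i : ℕ, x + 2 * i ≤ S.max' hS + 1 → x + 2 * i ∈ S := by
    intro x hx i
    induction i with
    | zero => simpa using fun _ => hx
    | succ i ih =>
      intro hi
      push_cast at hi ⊢
      have := hstep _ (ih (by omega)) (by omega)
      rwa [show x + 2 * ((i : ℤ) + 1) = x + 2 * i + 2 by ring]
  have hpar : ∀ x ∈ S, ∃ i : ℕ, S.max' hS = x + 2 * i := by
    intro x hx
    have hle := S.le_max' x hx
    by_contra hcon
    push Not at hcon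
    have hodd : (S.max' hS - x) % 2 = 1 := by
      by_contra hmod
      exact hcon ((S.max' hS - x) / 2).toNat (by omega)
    -- Steps of two from an element of the wrong parity would reach `S.max' hS + 1`.
    have := hup x hx ((S.max' hS + 1 - x) / 2).toNat (by omega)
    have := S.le_max' _ this
    omega
  obtain ⟨m, hm⟩ := hpar _ (S.min'_mem hS)
  have hmem : ∀ x, x ∈ S ↔ ∃ i : ℕ, i < m + 1 ∧ x = S.min' hS + 2 * i := by
    intro x
    constructor
    · intro hx
      obtain ⟨i, hi⟩ := hpar x hx
      have := S.min'_le x hx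
      exact ⟨m - i, by omega, by omega⟩
    · rintro ⟨i, hi, rfl⟩
      exact hup _ (S.min'_mem hS) i (by omega)
  have hcard : S = (Finset.range (m + 1)).image fun i : ℕ => S.min' hS + 2 * (i : ℤ) := by
    ext x
    rw [hmem, Finset.mem_image]
    simp only [Finset.mem_range, eq_comm]
  have hcard' := congrArg Finset.card hcard
  rw [Finset.card_image_of_injective _ (fun i j hij => by simpa using hij), Finset.card_range]
    at hcard'
  exact ⟨S.min' hS, by rwa [hcard']⟩

/-- The set of values of `x + y` on `X`. -/
def sums (X : Finset (ℤ × ℤ)) : Finset ℤ := (X.image diag).image Prod.fst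

/-- The set of values of `x - y` on `X`. -/
def diffs (X : Finset (ℤ × ℤ)) : Finset ℤ := (X.image diag).image Prod.snd

/-- The row bound is applied in one direction and then in the other. The extra 1 arises because the
first spread has already enlarged the set of values of x + y. -/
theorem card_nbr_ge {X : Finset (ℤ × ℤ)} (hX : X.Nonempty) :
    X.card + (sums X).card + (diffs X).card + 1 ≤ (nbr X).card := by
  have h1 := card_add_card_le_card_spreadFst (X.image diag)
  have h2 := card_add_card_le_card_spreadSnd (spreadFst (X.image diag))
  rw [← image_diag_nbr, image_fst_spreadFst, Finset.card_image_of_injective _ diag_injective] at h2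
  rw [Finset.card_image_of_injective _ diag_injective] at h1
  have h3 := card_lt_card_spread (S := sums X) ((hX.image _).image _)
  simp only [sums, diffs] at *
  omega

theorem image_diag_subset (X : Finset (ℤ × ℤ)) : X.image diag ⊆ sums X ×ˢ diffs X := fun _ hp =>
  Finset.mem_product.2 ⟨Finset.mem_image_of_mem _ hp, Finset.mem_image_of_mem _ hp⟩

theorem card_le_sums_mul_diffs (X : Finset (ℤ × ℤ)) : X.card ≤ (sums X).card * (diffs X).card := by
  rw [← Finset.card_image_of_injective X diag_injective, ← Finset.card_product]
  exact Finset.card_le_card (image_diag_subset X)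

/-- `X` consists of the points `(x, y)` with `x + y ∈ {a, a + 2, …, a + 2 (k - 1)}` and
`x - y ∈ {b, b + 2, …, b + 2 (k - 1)}`. -/
def IsDiagSquare (k : ℕ) (a b : ℤ) (X : Finset (ℤ × ℤ)) : Prop :=
  ∀ p : ℤ × ℤ, p ∈ X ↔
    (∃ i : ℕ, i < k ∧ p.1 + p.2 = a + 2 * i) ∧ ∃ j : ℕ, j < k ∧ p.1 - p.2 = b + 2 * j

/-- Two numbers with sum 2k and product at least k² both equal k, so `X` fills the product of its
projections. Its neighbourhood is then the product of their spreads, each of size at least k + 1,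
and the total (k + 1)² makes both projections progressions. -/
theorem exists_isDiagSquare {X : Finset (ℤ × ℤ)} {k : ℕ} (hX : X.Nonempty)
    (hcard : X.card = k ^ 2) (hsum : (sums X).card + (diffs X).card = 2 * k)
    (hnbr : (nbr X).card = (k + 1) ^ 2) : ∃ a b, IsDiagSquare k a b X := by
  have hle := card_le_sums_mul_diffs X
  have hs : (sums X).card = k := by
    zify at *
    have : ((sums X).card - k : ℤ) ^ 2 ≤ 0 := by nlinarith
    have := pow_eq_zero_iff (two_ne_zero) |>.1 (le_antisymm this (sq_nonneg _))
    omega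
  have hd : (diffs X).card = k := by omega
  have himg : X.image diag = sums X ×ˢ diffs X := by
    refine Finset.eq_of_subset_of_card_le (image_diag_subset X) ?_
    rw [Finset.card_product, Finset.card_image_of_injective _ diag_injective, hs, hd, hcard, sq]
  have hprod : (nbr X).image diag = spread (sums X) ×ˢ spread (diffs X) := by
    rw [image_diag_nbr, himg]
    ext p
    simp only [mem_spreadSnd, mem_spreadFst, Finset.mem_product, mem_spread]
    constructor
    · rintro ⟨q, ⟨w, ⟨hw1, hw2⟩, h1, h2⟩, h3, h4⟩
      exact ⟨⟨w.1, hw1, by omega⟩, ⟨w.2, hw2, by omega⟩⟩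
    · rintro ⟨⟨x, hx, h1⟩, ⟨y, hy, h2⟩⟩
      exact ⟨(p.1, y), ⟨(x, y), ⟨hx, hy⟩, h1, rfl⟩, h2, rfl⟩
  have hc : (spread (sums X)).card * (spread (diffs X)).card = (k + 1) ^ 2 := by
    rw [← Finset.card_product, ← hprod, Finset.card_image_of_injective _ diag_injective, hnbr]
  have hsne : (sums X).Nonempty := (hX.image _).image _
  have hdne : (diffs X).Nonempty := (hX.image _).image _
  have h1 := card_lt_card_spread hsne
  have h2 := card_lt_card_spread hdne
  rw [hs] at h1
  rw [hd] at h2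
  have h3 : (spread (sums X)).card = k + 1 := by nlinarith
  have h4 : (spread (diffs X)).card = k + 1 := by nlinarith
  obtain ⟨a, ha⟩ := exists_eq_progression hsne (by rw [h3, hs])
  obtain ⟨b, hb⟩ := exists_eq_progression hdne (by rw [h4, hd])
  refine ⟨a, b, fun p => ?_⟩
  rw [hs] at ha
  rw [hd] at hb
  rw [← diag_injective.mem_finset_image, himg, Finset.mem_product, ha, hb]
  rfl

/-! ### The isoperimetric inequality -/

/-- The points of `A` with `x + y` even. -/
def evens (A : Finset (ℤ × ℤ)) : Finset (ℤ × ℤ) := A.filter fun p => Even (p.1 + p.2)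

/-- The points of `A` with `x + y` odd. -/
def odds (A : Finset (ℤ × ℤ)) : Finset (ℤ × ℤ) := A.filter fun p => ¬Even (p.1 + p.2)

theorem card_evens_add_card_odds (A : Finset (ℤ × ℤ)) :
    (evens A).card + (odds A).card = A.card :=
  Finset.card_filter_add_card_filter_not _

theorem evens_union_odds (A : Finset (ℤ × ℤ)) : evens A ∪ odds A = A :=
  Finset.filter_union_filter_not_eq _ _

/-- Neighbours of even points are odd and conversely, so the boundary splits by parity. -/
theorem card_bd (A : Finset (ℤ × ℤ)) :
    (bd A).card = (nbr (evens A) \ odds A).card + (nbr (odds A) \ evens A).card := by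
  rw [← Finset.card_union_of_disjoint]
  · congr 1
    ext p
    simp only [bd, evens, odds, Finset.mem_union, Finset.mem_sdiff, mem_nbr, Finset.mem_filter,
      lattice_adj_iff]
    constructor
    · rintro ⟨⟨q, hq, h⟩, hp⟩
      by_cases he : Even (q.1 + q.2)
      · exact .inl ⟨⟨q, ⟨hq, he⟩, h⟩, fun h => hp h.1⟩
      · exact .inr ⟨⟨q, ⟨hq, he⟩, h⟩, fun h => hp h.1⟩
    · rintro (⟨⟨q, ⟨hq, he⟩, h⟩, hp⟩ | ⟨⟨q, ⟨hq, he⟩, h⟩, hp⟩)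
      · refine ⟨⟨q, hq, h⟩, fun hpA => hp ⟨hpA, ?_⟩⟩
        rw [Int.even_iff] at *
        omega
      · refine ⟨⟨q, hq, h⟩, fun hpA => hp ⟨hpA, ?_⟩⟩
        rw [Int.even_iff] at *
        omega
  · rw [Finset.disjoint_left]
    intro p hp hp'
    simp only [evens, odds, Finset.mem_sdiff, mem_nbr, Finset.mem_filter, lattice_adj_iff] at hp hp'
    obtain ⟨⟨q, ⟨-, hq⟩, h1, -⟩, -⟩ := hp
    obtain ⟨⟨w, ⟨-, hw⟩, h2, -⟩, -⟩ := hp'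
    rw [Int.even_iff] at *
    omega

/-- The half-perimeter of a set, with value `-1` for the empty set. -/
theorem exists_halfPerimeter (X : Finset (ℤ × ℤ)) : ∃ s : ℤ, 4 * (X.card : ℤ) ≤ s ^ 2 ∧
    X.card + s + 1 ≤ (nbr X).card ∧
    (X.card = 0 ∧ s = -1 ∨ 1 ≤ X.card ∧ 2 ≤ s ∧ s = (sums X).card + (diffs X).card) := by
  rcases X.eq_empty_or_nonempty with rfl | hX
  · exact ⟨-1, by simp⟩
  · have h1 := card_nbr_ge hX
    have h2 := card_le_sums_mul_diffs X
    have h3 : 0 < (sums X).card := ((hX.image _).image _).card_pos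
    have h4 : 0 < (diffs X).card := ((hX.image _).image _).card_pos
    refine ⟨(sums X).card + (diffs X).card, ?_, ?_, .inr ⟨hX.card_pos, ?_, rfl⟩⟩
    · zify at h2
      nlinarith [sq_nonneg ((sums X).card - (diffs X).card : ℤ)]
    · zify at h1
      linarith
    · omega

/-- If s ≤ t + 2, the identity 2(s² + t²) = (s + t)² + (s - t)² suffices. If s ≥ t + 3, then `h1`
bounds e by o + b - s - 1 and the inequality is strict, by (b - 2)² + 4 = (b - 6)² + 8b - 28. A
single point gives equality with o = 0, whence the condition 2 ≤ e + o. -/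
theorem isoperimetric_arith {e o s t b : ℤ} (he : 4 * e ≤ s ^ 2) (ho : 4 * o ≤ t ^ 2)
    (hb : s + t + 2 ≤ b) (h1 : e - o ≤ b - s - 1) (hts : t ≤ s)
    (hs : e = 0 ∧ s = -1 ∨ 1 ≤ e ∧ 2 ≤ s) (ht : o = 0 ∧ t = -1 ∨ 1 ≤ o ∧ 2 ≤ t)
    (hne : 1 ≤ e + o) :
    3 ≤ b ∧ 8 * (e + o) ≤ (b - 2) ^ 2 + 4 ∧ (2 ≤ e + o → (b - 2) ^ 2 + 4 ≤ 8 * (e + o) →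
      1 ≤ o ∧ s = t + 2 ∧ b = s + t + 2 ∧ 4 * e = s ^ 2 ∧ 4 * o = t ^ 2) := by
  have hs2 : 2 ≤ s := by omega
  refine ⟨by omega, ?_⟩
  rcases ht with ⟨rfl, rfl⟩ | ⟨ho1, ht2⟩
  · by_cases h3 : 3 ≤ s
    · have h4 : 8 * e < (b - 2) ^ 2 + 4 := by nlinarith [sq_nonneg (b - 6)]
      exact ⟨by linarith, fun _ _ => by linarith⟩
    · obtain rfl : s = 2 := by omega
      obtain rfl : e = 1 := by omega
      exact ⟨by nlinarith, fun _ _ => by omega⟩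
  · by_cases hd : s ≤ t + 2
    · have hsq : (s + t) ^ 2 ≤ (b - 2) ^ 2 := by nlinarith
      have hdq : (s - t) ^ 2 ≤ 4 := by nlinarith
      refine ⟨by nlinarith, fun _ hge => ?_⟩
      have e1 : 4 * e = s ^ 2 := by nlinarith
      have e2 : 4 * o = t ^ 2 := by nlinarith
      have e3 : 4 ≤ (s - t) ^ 2 := by nlinarith
      have e4 : (b - 2) ^ 2 ≤ (s + t) ^ 2 := by nlinarith
      exact ⟨ho1, by nlinarith, by nlinarith, e1, e2⟩
    · have h4 : 8 * (e + o) < (b - 2) ^ 2 + 4 := by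
        have : (2 * t - 1) ^ 2 ≤ (b - 6) ^ 2 := by nlinarith
        nlinarith
      exact ⟨by linarith, fun _ _ => by linarith⟩

/-- If the odd (or even) part `Y` of a set attains all the bounds of `isoperimetric_arith`, then the
other part `X` is its neighbourhood, and it is a diagonal square. -/
theorem extremal_structure {X Y : Finset (ℤ × ℤ)} {s t b : ℤ} {r : ℕ}
    (hN : X.card + s + 1 ≤ (nbr X).card) (hM : Y.card + t + 1 ≤ (nbr Y).card)
    (hb : ((nbr X \ Y).card : ℤ) + (nbr Y \ X).card = b) (hbst : b = s + t + 2)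
    (hst : s = t + 2) (hY : 4 * (Y.card : ℤ) = t ^ 2) (hX : 4 * (X.card : ℤ) = s ^ 2)
    (hpos : 1 ≤ Y.card) (ht : t = (sums Y).card + (diffs Y).card) (htr : t = 2 * r) :
    ∃ c d, IsDiagSquare r c d Y ∧ X = nbr Y := by
  have h1 := Finset.le_card_sdiff Y (nbr X)
  have h2 := Finset.le_card_sdiff X (nbr Y)
  have h3 : Y.card = r ^ 2 := by zify; rw [htr] at hY; linarith
  have h4 : X.card = (r + 1) ^ 2 := by zify; rw [hst, htr] at hX; linarith
  -- The lower bounds |X| + s + 1 - |Y| and |Y| + t + 1 - |X| for the two differences add up to `b`,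
  -- so both are attained.
  have h5 : (nbr Y).card = X.card := by
    have : (nbr Y).card = Y.card + t + 1 := by omega
    zify
    zify at h3 h4
    rw [this, h3, h4, htr]
    ring
  have h6 : (nbr Y \ X).card = 0 := by omega
  rw [Finset.card_eq_zero, Finset.sdiff_eq_empty_iff_subset] at h6
  obtain ⟨c, d, hcd⟩ := exists_isDiagSquare (k := r) (Finset.card_pos.1 hpos) h3 (by omega)
    (h5.trans h4)
  exact ⟨c, d, hcd, (Finset.eq_of_subset_of_card_le h6 h5.ge).symm⟩

theorem isoperimetric {A : Finset (ℤ × ℤ)} (hA : A.Nonempty) :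
    3 ≤ (bd A).card ∧ 8 * (A.card : ℤ) ≤ ((bd A).card - 2 : ℤ) ^ 2 + 4 := by
  obtain ⟨s, hs1, hs2, hs3⟩ := exists_halfPerimeter (evens A)
  obtain ⟨t, ht1, ht2, ht3⟩ := exists_halfPerimeter (odds A)
  have hb := card_bd A
  have hc := card_evens_add_card_odds A
  have h1 := Finset.le_card_sdiff (odds A) (nbr (evens A))
  have h2 := Finset.le_card_sdiff (evens A) (nbr (odds A))
  have hpos := hA.card_pos
  rw [← hc]
  rcases le_total t s with hts | hts
  · have := isoperimetric_arith (e := (evens A).card) (o := (odds A).card) (b := (bd A).card)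
      hs1 ht1 (by omega) (by omega) hts (by omega) (by omega) (by omega)
    exact ⟨by exact_mod_cast this.1, by exact_mod_cast this.2.1⟩
  · have := isoperimetric_arith (e := (odds A).card) (o := (evens A).card) (b := (bd A).card)
      ht1 hs1 (by omega) (by omega) hts (by omega) (by omega) (by omega)
    rw [add_comm (evens A).card]
    exact ⟨by exact_mod_cast this.1, by exact_mod_cast this.2.1⟩

/-- Here 8|A| = (4r + 2)² + 4, so a boundary of at most 4r + 4 points puts `A` in the equality case
of the isoperimetric inequality. -/
theorem exists_eq_ball {A : Finset (ℤ × ℤ)} {r : ℕ} (hr : 1 ≤ r)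
    (hA : A.card = 2 * r ^ 2 + 2 * r + 1) (hbd : (bd A).card ≤ 4 * r + 4) :
    ∃ Y c d, IsDiagSquare r c d Y ∧ A = Y ∪ nbr Y := by
  obtain ⟨s, hs1, hs2, hs3⟩ := exists_halfPerimeter (evens A)
  obtain ⟨t, ht1, ht2, ht3⟩ := exists_halfPerimeter (odds A)
  have hb := card_bd A
  have hc := card_evens_add_card_odds A
  have h1 := Finset.le_card_sdiff (odds A) (nbr (evens A))
  have h2 := Finset.le_card_sdiff (evens A) (nbr (odds A))
  have hn2 : 2 ≤ A.card := by nlinarith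
  have hge : ((bd A).card - 2 : ℤ) ^ 2 + 4 ≤ 8 * A.card := by
    have h3 := (isoperimetric (Finset.card_pos.1 (by omega : 0 < A.card))).1
    rw [hA]
    push_cast
    zify at h3 hbd
    nlinarith
  have hb4 : ((bd A).card : ℤ) = 4 * r + 4 := by
    have h3 := (isoperimetric (Finset.card_pos.1 (by omega : 0 < A.card)))
    have h4 := h3.2
    rw [hA] at h4
    push_cast at h4
    zify at h3 hbd
    nlinarith [h3.1]
  have hbc := congrArg (Nat.cast : ℕ → ℤ) hb
  push_cast at hbc
  rcases le_total t s with hts | hts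
  · obtain ⟨h5, h6, h7, h8, h9⟩ := (isoperimetric_arith (e := (evens A).card) (o := (odds A).card)
      (b := (bd A).card) hs1 ht1 (by omega) (by omega) hts (by omega) (by omega)
      (by omega)).2.2 (by omega) (by rwa [← Nat.cast_add, hc])
    obtain ⟨c, d, hcd, hE⟩ := extremal_structure (r := r) hs2 ht2 hbc.symm h7 h6 h9 h8
      (by omega) (by omega) (by omega)
    refine ⟨odds A, c, d, hcd, ?_⟩
    rw [← hE, Finset.union_comm, evens_union_odds]
  · obtain ⟨h5, h6, h7, h8, h9⟩ := (isoperimetric_arith (e := (odds A).card) (o := (evens A).card)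
      (b := (bd A).card) ht1 hs1 (by omega) (by omega) hts (by omega) (by omega)
      (by omega)).2.2 (by omega) (by rwa [← Nat.cast_add, add_comm (odds A).card, hc])
    obtain ⟨c, d, hcd, hE⟩ := extremal_structure (r := r) ht2 hs2 (by rw [add_comm]; exact hbc.symm)
      h7 h6 h9 h8 (by omega) (by omega) (by omega)
    refine ⟨evens A, c, d, hcd, ?_⟩
    rw [← hE, evens_union_odds]

/-! ### Minimality, congruence and adjacency for finite sets -/

theorem isMinimal_coe_iff {A : Finset (ℤ × ℤ)} : IsMinimal lattice (A : Set (ℤ × ℤ)) ↔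
    A.Nonempty ∧ ∀ B : Finset (ℤ × ℤ), B.card = A.card → (bd A).card ≤ (bd B).card := by
  constructor
  · rintro ⟨h1, -, h3⟩
    refine ⟨by exact_mod_cast h1, fun B hB => ?_⟩
    have := h3 B (by simp [Set.encard_coe_eq_coe_finsetCard, hB])
    rwa [← coe_bd, ← coe_bd, Set.encard_coe_eq_coe_finsetCard, Set.encard_coe_eq_coe_finsetCard,
      Nat.cast_le] at this
  · rintro ⟨h1, h2⟩
    refine ⟨by exact_mod_cast h1, A.finite_toSet, fun B hB => ?_⟩
    have hfin : B.Finite := by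
      rw [← Set.encard_lt_top_iff, hB]
      exact A.finite_toSet.encard_lt_top
    obtain ⟨B, rfl⟩ := hfin.exists_finset_coe
    rw [Set.encard_coe_eq_coe_finsetCard, Set.encard_coe_eq_coe_finsetCard, Nat.cast_inj] at hB
    rw [← coe_bd, ← coe_bd, Set.encard_coe_eq_coe_finsetCard, Set.encard_coe_eq_coe_finsetCard,
      Nat.cast_le]
    exact h2 B hB

/-- By the isoperimetric inequality a set with at most m boundary points is too small to have |A|
points. -/
theorem isMinimal_of_card_bd_le {A : Finset (ℤ × ℤ)} {m : ℕ}
    (hbd : (bd A).card ≤ m + 1) (hA : (m - 2 : ℤ) ^ 2 + 4 < 8 * A.card) :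
    IsMinimal lattice (A : Set (ℤ × ℤ)) := by
  have hpos : 0 < A.card := by zify; nlinarith [sq_nonneg (m - 2 : ℤ)]
  refine isMinimal_coe_iff.2 ⟨Finset.card_pos.1 hpos, fun B hB => hbd.trans ?_⟩
  obtain ⟨h1, h2⟩ := isoperimetric (Finset.card_pos.1 (hB ▸ hpos))
  rw [hB] at h2
  by_contra hlt
  have h3 : ((bd B).card : ℤ) ≤ m := by omega
  zify at h1
  nlinarith

theorem vertexBoundary_image {V : Type*} {X : SimpleGraph V} (φ : X ≃g X) (A : Set V) :
    vertexBoundary X (φ '' A) = φ '' vertexBoundary X A := by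
  ext u
  obtain ⟨u, rfl⟩ := φ.surjective u
  simp only [vertexBoundary, φ.injective.mem_set_image, Set.mem_ofPred_eq, Set.exists_mem_image,
    φ.map_adj_iff]

theorem IsMinimal.of_congruent {V : Type*} {X : SimpleGraph V} {A B : Set V} (hA : IsMinimal X A)
    (h : Congruent X A B) : IsMinimal X B := by
  have hcard := h.encard_eq
  obtain ⟨φ, rfl⟩ := h
  refine ⟨hA.nonempty.image _, hA.finite.image _, fun B hB => ?_⟩
  rw [vertexBoundary_image, φ.injective.encard_image]
  exact hA.boundary_le B (hB.trans hcard.symm)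

theorem card_bd_eq_of_congruent {A B : Finset (ℤ × ℤ)}
    (h : Congruent lattice (A : Set (ℤ × ℤ)) B) : (bd A).card = (bd B).card := by
  obtain ⟨φ, h⟩ := h
  have := vertexBoundary_image φ (A : Set (ℤ × ℤ))
  rw [h, ← coe_bd, ← coe_bd] at this
  have := congrArg Set.encard this
  rw [φ.injective.encard_image, Set.encard_coe_eq_coe_finsetCard,
    Set.encard_coe_eq_coe_finsetCard, Nat.cast_inj] at this
  exact this.symm

/-- Translation, as an automorphism of the lattice. -/
def translation (t : ℤ × ℤ) : lattice ≃g lattice where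
  toEquiv := Equiv.addRight t
  map_rel_iff' := by
    intro p q
    simp only [lattice_adj_iff, Equiv.coe_addRight, Prod.fst_add, Prod.snd_add]
    omega

/-- The reflection `(x, y) ↦ (x, -y)`, as an automorphism of the lattice. -/
def reflection : lattice ≃g lattice where
  toEquiv := (Equiv.refl ℤ).prodCongr (Equiv.neg ℤ)
  map_rel_iff' := by
    intro p q
    simp only [lattice_adj_iff, Equiv.prodCongr_apply, Prod.map, Equiv.refl_apply, Equiv.neg_apply]
    omega

/-- The reflection `(x, y) ↦ (y, x)`, as an automorphism of the lattice. -/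
def transposition : lattice ≃g lattice where
  toEquiv := Equiv.prodComm ℤ ℤ
  map_rel_iff' := by
    intro p q
    simp only [lattice_adj_iff, Equiv.prodComm_apply, Prod.fst_swap, Prod.snd_swap]
    omega

theorem congruent_image (φ : lattice ≃g lattice) (A : Finset (ℤ × ℤ)) :
    Congruent lattice (A : Set (ℤ × ℤ)) (A.image φ : Finset (ℤ × ℤ)) :=
  ⟨φ, by rw [Finset.coe_image]⟩

/-- `A` is minimal and its class can be reached from the class `v` in the graph of minimal sets. -/
def ReachableFrom (v : MinimalClass lattice) (A : Finset (ℤ × ℤ)) : Prop :=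
  ∃ h : IsMinimal lattice (A : Set (ℤ × ℤ)),
    (minimalGraph lattice).Reachable v (Quotient.mk (congruence lattice) ⟨A, h⟩)

theorem ReachableFrom.insert {v : MinimalClass lattice} {A : Finset (ℤ × ℤ)} {w : ℤ × ℤ}
    (hA : ReachableFrom v A) (hw : w ∉ A)
    (h : IsMinimal lattice ((Insert.insert w A : Finset (ℤ × ℤ)) : Set (ℤ × ℤ))) :
    ReachableFrom v (Insert.insert w A) := by
  obtain ⟨hmin, hreach⟩ := hA
  refine ⟨h, hreach.trans (SimpleGraph.Adj.reachable ⟨⟨_, hmin⟩, ⟨_, h⟩, rfl, rfl, ?_⟩)⟩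
  have : symmDiff (A : Set (ℤ × ℤ)) ((Insert.insert w A : Finset (ℤ × ℤ)) : Set (ℤ × ℤ)) = {w} := by
    ext p
    simp only [Set.mem_symmDiff, Finset.coe_insert, Set.mem_insert_iff, Finset.mem_coe,
      Set.mem_singleton_iff]
    constructor
    · tauto
    · rintro rfl
      exact .inr ⟨.inl rfl, hw⟩
  rw [this, Set.encard_singleton]

theorem ReachableFrom.of_congruent {v : MinimalClass lattice} {A B : Finset (ℤ × ℤ)}
    (hA : ReachableFrom v A) (h : Congruent lattice (A : Set (ℤ × ℤ)) B) : ReachableFrom v B := by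
  obtain ⟨hmin, hreach⟩ := hA
  refine ⟨hmin.of_congruent h, ?_⟩
  have : Quotient.mk (congruence lattice) ⟨B, hmin.of_congruent h⟩ =
      Quotient.mk (congruence lattice) ⟨A, hmin⟩ := (Quotient.sound h).symm
  rwa [this]

/-! ### A chain of minimal sets -/

/-- Adding `w` removes it from the boundary, and only points of `Z` can enter. -/
theorem card_bd_insert_le {A Z : Finset (ℤ × ℤ)} {w : ℤ × ℤ} (hw : w ∈ bd A)
    (h : ∀ x, lattice.Adj x w → x ∈ A ∨ x ∈ bd A ∨ x ∈ Z) :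
    (bd (insert w A)).card + 1 ≤ (bd A).card + Z.card := by
  have hsub : bd (insert w A) ⊆ (bd A).erase w ∪ Z := by
    intro x hx
    rw [bd, Finset.mem_sdiff, mem_nbr, Finset.mem_insert, not_or] at hx
    obtain ⟨⟨q, hq, hadj⟩, hxw, hxA⟩ := hx
    rw [Finset.mem_union, Finset.mem_erase]
    rcases Finset.mem_insert.1 hq with rfl | hq
    · rcases h x hadj with h | h | h
      · exact absurd h hxA
      · exact .inl ⟨hxw, h⟩
      · exact .inr h
    · exact .inl ⟨hxw, Finset.mem_sdiff.2 ⟨mem_nbr.2 ⟨q, hq, hadj⟩, hxA⟩⟩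
  have h1 := (Finset.card_le_card hsub).trans (Finset.card_union_le _ _)
  rw [Finset.card_erase_of_mem hw] at h1
  have := Finset.card_pos.2 ⟨w, hw⟩
  omega

/-- The points of the diagonal box `0 ≤ x + y ≤ p`, `0 ≤ x - y ≤ q`, together with those points on
the next side `x + y = p + 1` for which `0 ≤ x - y < t`. -/
noncomputable def stair (p q t : ℕ) : Finset (ℤ × ℤ) :=
  -- This square only ensures finiteness: the inequalities below already place `w` in it.
  (Finset.Icc (-(p + q + t + 2) : ℤ) (p + q + t + 2) ×ˢ
    Finset.Icc (-(p + q + t + 2) : ℤ) (p + q + t + 2)).filter fun w =>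
      0 ≤ w.1 - w.2 ∧ (0 ≤ w.1 + w.2 ∧ w.1 + w.2 ≤ p ∧ w.1 - w.2 ≤ q ∨
        w.1 + w.2 = p + 1 ∧ w.1 - w.2 < t)

theorem mem_stair {p q t : ℕ} {w : ℤ × ℤ} : w ∈ stair p q t ↔
    0 ≤ w.1 - w.2 ∧ (0 ≤ w.1 + w.2 ∧ w.1 + w.2 ≤ p ∧ w.1 - w.2 ≤ q ∨
        w.1 + w.2 = p + 1 ∧ w.1 - w.2 < t) := by
  rw [stair, Finset.mem_filter, Finset.mem_product, Finset.mem_Icc, Finset.mem_Icc]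
  constructor
  · exact fun h => h.2
  · exact fun h => ⟨by omega, h⟩

theorem stair_full (p q : ℕ) : stair p q (q + 1) = stair (p + 1) q 0 := by
  ext w
  rw [mem_stair, mem_stair]
  push_cast
  omega

theorem congruent_stair_swap (p q : ℕ) :
    Congruent lattice (stair p q 0 : Set (ℤ × ℤ)) (stair q p 0) := by
  refine ⟨reflection, ?_⟩
  ext w
  rw [Set.mem_image, Finset.mem_coe, mem_stair]
  constructor
  · rintro ⟨x, hx, rfl⟩
    rw [Finset.mem_coe, mem_stair] at hx
    change 0 ≤ x.1 - -x.2 ∧ (0 ≤ x.1 + -x.2 ∧ x.1 + -x.2 ≤ q ∧ x.1 - -x.2 ≤ p ∨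
      x.1 + -x.2 = q + 1 ∧ x.1 - -x.2 < (0 : ℕ))
    omega
  · intro h
    refine ⟨(w.1, -w.2), ?_, Prod.ext rfl (neg_neg _)⟩
    rw [Finset.mem_coe, mem_stair]
    dsimp only
    omega

theorem stair_succ_of_mod_eq {p q t : ℕ} (h : t % 2 = p % 2) :
    stair p q (t + 1) = stair p q t := by
  ext w
  rw [mem_stair, mem_stair]
  push_cast
  omega

/-- The point with `x + y = p + 1` and `x - y = t`. -/
def sidePoint (p t : ℕ) : ℤ × ℤ := ((p + 1 + t) / 2, (p + 1 - t) / 2)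

theorem sidePoint_add {p t : ℕ} (h : t % 2 ≠ p % 2) :
    (sidePoint p t).1 + (sidePoint p t).2 = p + 1 := by
  dsimp only [sidePoint]
  omega

theorem sidePoint_sub (p t : ℕ) :
    (sidePoint p t).1 - (sidePoint p t).2 = t := by
  dsimp only [sidePoint]
  omega

theorem stair_succ_of_mod_ne {p q t : ℕ} (h : t % 2 ≠ p % 2) :
    stair p q (t + 1) = insert (sidePoint p t) (stair p q t) := by
  have h1 := sidePoint_add h
  have h2 := sidePoint_sub p t
  ext w
  rw [Finset.mem_insert, mem_stair, mem_stair, Prod.ext_iff]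
  push_cast
  omega

theorem sidePoint_notMem {p q t : ℕ} (h : t % 2 ≠ p % 2) : sidePoint p t ∉ stair p q t := by
  have h1 := sidePoint_add h
  have h2 := sidePoint_sub p t
  rw [mem_stair]
  omega

theorem mem_bd_stair {p q t : ℕ} {w z : ℤ × ℤ} (hz : z ∈ stair p q t) (hw : w ∉ stair p q t)
    (hs : w.1 + w.2 = z.1 + z.2 + 1 ∨ w.1 + w.2 = z.1 + z.2 - 1)
    (hd : w.1 - w.2 = z.1 - z.2 + 1 ∨ w.1 - w.2 = z.1 - z.2 - 1) : w ∈ bd (stair p q t) :=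
  Finset.mem_sdiff.2 ⟨mem_nbr.2 ⟨z, hz, (lattice_adj_iff _ _).2 ⟨hs, hd⟩⟩, hw⟩

theorem sidePoint_mem_bd {p q t : ℕ} (hq : 1 ≤ q) (ht : t ≤ q) (h : t % 2 ≠ p % 2) :
    sidePoint p t ∈ bd (stair p q t) := by
  have h1 := sidePoint_add h
  have h2 := sidePoint_sub p t
  rcases Nat.eq_zero_or_pos t with rfl | ht0
  · refine mem_bd_stair (z := ((sidePoint p 0).1, (sidePoint p 0).2 - 1)) ?_ (sidePoint_notMem h)
      (by dsimp only; omega) (by dsimp only; omega)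
    rw [mem_stair]
    dsimp only
    omega
  · refine mem_bd_stair (z := ((sidePoint p t).1 - 1, (sidePoint p t).2)) ?_ (sidePoint_notMem h)
      (by dsimp only; omega) (by dsimp only; omega)
    rw [mem_stair]
    dsimp only
    omega

/-- Every neighbour of the next side point, except those on the line `x + y = p + 2`, belongs to
the closed neighbourhood of the box. -/
theorem mem_or_mem_bd_of_adj_sidePoint {p q t : ℕ} (hp : 1 ≤ p) (ht : t ≤ q)
    (h : t % 2 ≠ p % 2) {x : ℤ × ℤ} (hadj : lattice.Adj x (sidePoint p t))
    (hx : x.1 + x.2 ≠ p + 2) : x ∈ stair p q t ∨ x ∈ bd (stair p q t) := by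
  have h1 := sidePoint_add h
  have h2 := sidePoint_sub p t
  rw [lattice_adj_iff] at hadj
  by_cases hxm : x ∈ stair p q t
  · exact .inl hxm
  right
  have hxm' := hxm
  rw [mem_stair] at hxm'
  rcases hadj.2 with h3 | h3
  · refine mem_bd_stair (z := (x.1 - 1, x.2)) ?_ hxm (by dsimp only; omega) (by dsimp only; omega)
    rw [mem_stair]
    dsimp only
    omega
  · refine mem_bd_stair (z := (x.1, x.2 - 1)) ?_ hxm (by dsimp only; omega) (by dsimp only; omega)
    rw [mem_stair]
    dsimp only
    omega

/-- The new point leaves the boundary and at most its two outer neighbours, on x + y = p + 2, enter.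
-/
theorem card_bd_stair_succ_first {p q t : ℕ} (hp : 1 ≤ p) (hq : 1 ≤ q) (ht : t ≤ q)
    (h : t % 2 ≠ p % 2) : (bd (stair p q (t + 1))).card ≤ (bd (stair p q t)).card + 1 := by
  have h1 := sidePoint_add h
  have h2 := sidePoint_sub p t
  rw [stair_succ_of_mod_ne h]
  have h3 := card_bd_insert_le (sidePoint_mem_bd hq ht h)
    (Z := {((sidePoint p t).1 + 1, (sidePoint p t).2), ((sidePoint p t).1, (sidePoint p t).2 + 1)})
    fun x hadj => by
      by_cases hx : x.1 + x.2 = p + 2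
      · right; right
        rw [lattice_adj_iff] at hadj
        rw [Finset.mem_insert, Finset.mem_singleton, Prod.ext_iff, Prod.ext_iff]
        dsimp only
        omega
      · have := mem_or_mem_bd_of_adj_sidePoint hp ht h hadj hx
        tauto
  have h4 := Finset.card_le_two (a := ((sidePoint p t).1 + 1, (sidePoint p t).2))
    (b := ((sidePoint p t).1, (sidePoint p t).2 + 1))
  omega

/-- For t ≥ 2 the preceding side point, at x - y = t - 2, already has one of the two outer
neighbours in its boundary, so at most one point enters. -/
theorem card_bd_stair_succ {p q t : ℕ} (hp : 1 ≤ p) (hq : 1 ≤ q) (ht : t ≤ q)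
    (h : t % 2 ≠ p % 2) (h2t : 2 ≤ t) :
    (bd (stair p q (t + 1))).card ≤ (bd (stair p q t)).card := by
  have h1 := sidePoint_add h
  have h2 := sidePoint_sub p t
  rw [stair_succ_of_mod_ne h]
  have h3 := card_bd_insert_le (sidePoint_mem_bd hq ht h)
    (Z := {((sidePoint p t).1 + 1, (sidePoint p t).2)}) fun x hadj => by
      by_cases hx : x.1 + x.2 = p + 2
      · rw [lattice_adj_iff] at hadj
        rcases hadj.2 with h4 | h4
        · right; right
          rw [Finset.mem_singleton, Prod.ext_iff]
          dsimp only
          omega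
        · by_cases hxm : x ∈ stair p q t
          · exact .inl hxm
          · right; left
            refine mem_bd_stair (z := (x.1 - 1, x.2)) ?_ hxm (by dsimp only; omega)
              (by dsimp only; omega)
            rw [mem_stair]
            dsimp only
            omega
      · have := mem_or_mem_bd_of_adj_sidePoint hp ht h hadj hx
        tauto
  rw [Finset.card_singleton] at h3
  omega

/-- The diagonal box with sides `p` and `q` is minimal, with the expected size and boundary, and its
class can be reached from the class `v`. -/
structure ReachableBox (v : MinimalClass lattice) (p q : ℕ) : Prop where
  reachable : ReachableFrom v (stair p q 0)
  card : (stair p q 0).card = ((p + 1) * (q + 1) + 1) / 2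
  card_bd : (bd (stair p q 0)).card ≤ p + q + 4

theorem ReachableBox.swap {v : MinimalClass lattice} {p q : ℕ} (h : ReachableBox v p q) :
    ReachableBox v q p where
  reachable := h.reachable.of_congruent (congruent_stair_swap p q)
  card := by
    have := (congruent_stair_swap p q).encard_eq
    rw [Set.encard_coe_eq_coe_finsetCard, Set.encard_coe_eq_coe_finsetCard, Nat.cast_inj] at this
    rw [← this, h.card, mul_comm]
  card_bd := by
    rw [← card_bd_eq_of_congruent (congruent_stair_swap p q), add_comm q p]
    exact h.card_bd

/-- A side under construction costs one boundary point in total, at its first point; the `min`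
records this. The term `p % 2` appears because side points have x - y of parity opposite to p. -/
theorem ReachableBox.stair {v : MinimalClass lattice} {p q : ℕ} (h : ReachableBox v p q)
    (hp : 1 ≤ p) (hpq : q = p ∨ q = p + 1) (t : ℕ) (ht : t ≤ q + 1) :
    ReachableFrom v (stair p q t) ∧
      (MinimalSets.stair p q t).card = ((p + 1) * (q + 1) + 1) / 2 + (t + p % 2) / 2 ∧
      (bd (MinimalSets.stair p q t)).card ≤ p + q + 4 + min 1 ((t + p % 2) / 2) := by
  induction t with
  | zero =>
    have : (0 + p % 2) / 2 = 0 := by omega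
    rw [this]
    exact ⟨h.reachable, h.card, h.card_bd⟩
  | succ t ih =>
    obtain ⟨h1, h2, h3⟩ := ih (by omega)
    by_cases hmod : t % 2 = p % 2
    · rw [stair_succ_of_mod_eq hmod, show (t + 1 + p % 2) / 2 = (t + p % 2) / 2 by omega]
      exact ⟨h1, h2, h3⟩
    · have hcard : (MinimalSets.stair p q (t + 1)).card =
          ((p + 1) * (q + 1) + 1) / 2 + (t + 1 + p % 2) / 2 := by
        rw [stair_succ_of_mod_ne hmod, Finset.card_insert_of_notMem (sidePoint_notMem hmod), h2]
        omega
      have hbd : (bd (MinimalSets.stair p q (t + 1))).card ≤ p + q + 4 + 1 := by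
        by_cases h2t : 2 ≤ t
        · have := card_bd_stair_succ hp (by omega) (by omega) hmod h2t (q := q)
          omega
        · have := card_bd_stair_succ_first hp (by omega) (by omega) hmod (q := q)
          omega
      refine ⟨?_, hcard, by omega⟩
      have hmin : IsMinimal lattice (MinimalSets.stair p q (t + 1) : Set (ℤ × ℤ)) := by
        refine isMinimal_of_card_bd_le hbd ?_
        -- Minimality needs (p + q + 2)² + 4 < 4(p + 1)(q + 1) + 8, that is (p - q)² < 4, which
        -- holds as q is p or p + 1.
        have h4 : (p + 1) * (q + 1) + 2 ≤ 2 * (MinimalSets.stair p q (t + 1)).card := by omega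
        zify at h4
        push_cast
        rcases hpq with rfl | rfl
        · nlinarith
        · push_cast at *
          nlinarith
      rw [stair_succ_of_mod_ne hmod] at hmin ⊢
      exact h1.insert (sidePoint_notMem hmod) hmin

theorem ReachableBox.succ {v : MinimalClass lattice} {p q : ℕ} (h : ReachableBox v p q)
    (hp : 1 ≤ p) (hpq : q = p ∨ q = p + 1) : ReachableBox v (p + 1) q := by
  obtain ⟨h1, h2, h3⟩ := h.stair hp hpq (q + 1) le_rfl
  rw [stair_full] at h1 h2 h3
  refine ⟨h1, h2.trans ?_, by omega⟩
  rcases Nat.even_or_odd' p with ⟨m, rfl | rfl⟩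
  · have e1 : (2 * m + 1) * (q + 1) = 2 * (m * (q + 1)) + (q + 1) := by ring
    have e2 : (2 * m + 1 + 1) * (q + 1) = 2 * (m * (q + 1)) + 2 * (q + 1) := by ring
    omega
  · have e1 : (2 * m + 1 + 1) * (q + 1) = 2 * (m * (q + 1)) + 2 * (q + 1) := by ring
    have e2 : (2 * m + 1 + 1 + 1) * (q + 1) = 2 * (m * (q + 1)) + 3 * (q + 1) := by ring
    omega

theorem stair_one_one : stair 1 1 0 = {(0, 0), (1, 0)} := by decide

theorem card_bd_pair : (bd {(0, 0), (1, 0)}).card = 6 := by decide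

theorem isMinimal_pair :
    IsMinimal lattice (({(0, 0), (1, 0)} : Finset (ℤ × ℤ)) : Set (ℤ × ℤ)) :=
  isMinimal_of_card_bd_le (m := 5) card_bd_pair.le (by decide)

/-- The class of a pair of neighbouring vertices. -/
def pairClass : MinimalClass lattice := Quotient.mk (congruence lattice) ⟨_, isMinimal_pair⟩

theorem reachableBox_self (k : ℕ) : ReachableBox pairClass (k + 1) (k + 1) := by
  induction k with
  | zero =>
    refine ⟨?_, by decide, ?_⟩
    · rw [stair_one_one]
      exact ⟨isMinimal_pair, SimpleGraph.Reachable.refl _⟩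
    · rw [stair_one_one]
      exact card_bd_pair.le
  | succ k ih =>
    -- One side is lengthened, then the reflected box is lengthened along its shorter side.
    exact ((ih.succ (by omega) (.inl rfl)).swap).succ (by omega) (.inr rfl)

/-! ### Finiteness of the number of classes of a given size -/

theorem bd_union_subset (A B : Finset (ℤ × ℤ)) : bd (A ∪ B) ⊆ bd A ∪ bd B := by
  intro p hp
  simp only [bd, Finset.mem_sdiff, Finset.mem_union, mem_nbr] at *
  obtain ⟨⟨q, hq | hq, h⟩, hp⟩ := hp
  · exact .inl ⟨⟨q, hq, h⟩, fun h => hp (.inl h)⟩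
  · exact .inr ⟨⟨q, hq, h⟩, fun h => hp (.inr h)⟩

/-- The columns met by a minimal set have no gap of width two or more. -/
theorem IsMinimal.exists_column {A : Finset (ℤ × ℤ)} (hA : IsMinimal lattice (A : Set (ℤ × ℤ)))
    {a b : ℤ × ℤ} (ha : a ∈ A) (hb : b ∈ A) {m : ℤ} (ham : a.1 ≤ m) (hmb : m + 3 ≤ b.1) :
    ∃ w ∈ A, w.1 = m + 1 ∨ w.1 = m + 2 := by
  by_contra! hgap
  set L := A.filter fun p => p.1 ≤ m with hL
  set R := A.filter fun p => ¬p.1 ≤ m with hR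
  have hLR : L ∪ R = A := Finset.filter_union_filter_not_eq _ _
  have hcard : L.card + R.card = A.card := Finset.card_filter_add_card_filter_not _
  have hRge : ∀ p ∈ R, m + 3 ≤ p.1 := by
    intro p hp
    rw [hR, Finset.mem_filter] at hp
    have := hgap p hp.1
    omega
  have hLle : ∀ p ∈ L, p.1 ≤ m := fun p hp => (Finset.mem_filter.1 hp).2
  obtain ⟨l, hl, hlmax⟩ := L.exists_max_image Prod.fst ⟨a, Finset.mem_filter.2 ⟨ha, ham⟩⟩
  obtain ⟨r, hr, hrmin⟩ := R.exists_min_image Prod.fst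
    ⟨b, Finset.mem_filter.2 ⟨hb, by omega⟩⟩
  -- Two empty columns make the boundaries of `L` and `R` disjoint. This translation puts `r` two
  -- steps to the right of `l`, so that the boundaries share the point between them while `L` and
  -- `R'` stay disjoint; the total boundary drops.
  set t : ℤ × ℤ := (l.1 + 2 - r.1, l.2 - r.2) with ht
  set R' := R.image (translation t) with hR'
  have hR'mem : ∀ p ∈ R', l.1 + 2 ≤ p.1 := by
    intro p hp
    obtain ⟨q, hq, rfl⟩ := Finset.mem_image.1 hp
    change l.1 + 2 ≤ q.1 + (l.1 + 2 - r.1)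
    have := hrmin q hq
    omega
  have hR'card : R'.card = R.card := Finset.card_image_of_injective _ (translation t).injective
  have hbdR' : (bd R').card = (bd R).card :=
    (card_bd_eq_of_congruent (congruent_image (translation t) R)).symm
  have hdisj : Disjoint L R' := by
    rw [Finset.disjoint_left]
    intro p hp hp'
    have := hlmax p hp
    have := hR'mem p hp'
    omega
  have hmin := (isMinimal_coe_iff.1 hA).2 (L ∪ R')
    (by rw [Finset.card_union_of_disjoint hdisj, hR'card, hcard])
  have hbdA : (bd L).card + (bd R).card ≤ (bd A).card := by
    rw [← Finset.card_union_of_disjoint]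
    · refine Finset.card_le_card fun p hp => ?_
      rw [← hLR]
      simp only [bd, Finset.mem_union, Finset.mem_sdiff, mem_nbr] at hp ⊢
      rcases hp with ⟨⟨q, hq, h⟩, hp⟩ | ⟨⟨q, hq, h⟩, hp⟩
      · refine ⟨⟨q, .inl hq, h⟩, ?_⟩
        rintro (h' | h')
        · exact hp h'
        · have := hLle q hq
          have := hRge p h'
          rw [lattice_adj_iff] at h
          omega
      · refine ⟨⟨q, .inr hq, h⟩, ?_⟩
        rintro (h' | h')
        · have := hRge q hq
          have := hLle p h'
          rw [lattice_adj_iff] at h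
          omega
        · exact hp h'
    · rw [Finset.disjoint_left]
      intro p hp hp'
      simp only [bd, Finset.mem_sdiff, mem_nbr, lattice_adj_iff] at hp hp'
      obtain ⟨⟨q, hq, h⟩, -⟩ := hp
      obtain ⟨⟨w, hw, h'⟩, -⟩ := hp'
      have := hLle q hq
      have := hRge w hw
      omega
  have hmeet : (l.1 + 1, l.2) ∈ bd L ∩ bd R' := by
    simp only [bd, Finset.mem_inter, Finset.mem_sdiff, mem_nbr, lattice_adj_iff]
    refine ⟨⟨⟨l, hl, by omega⟩, fun h => ?_⟩, ⟨translation t r, Finset.mem_image_of_mem _ hr, ?_⟩,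
      fun h => ?_⟩
    · have := hlmax _ h
      dsimp only at this
      omega
    · change (l.1 + 1 + l.2 = (r.1 + (l.1 + 2 - r.1)) + (r.2 + (l.2 - r.2)) + 1 ∨
        l.1 + 1 + l.2 = (r.1 + (l.1 + 2 - r.1)) + (r.2 + (l.2 - r.2)) - 1) ∧
        (l.1 + 1 - l.2 = (r.1 + (l.1 + 2 - r.1)) - (r.2 + (l.2 - r.2)) + 1 ∨
        l.1 + 1 - l.2 = (r.1 + (l.1 + 2 - r.1)) - (r.2 + (l.2 - r.2)) - 1)
      omega
    · have := hR'mem _ h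
      dsimp only at this
      omega
  have h1 := Finset.card_le_card (bd_union_subset L R')
  have h2 := Finset.card_union_add_card_inter (bd L) (bd R')
  have h3 := Finset.card_pos.2 ⟨_, hmeet⟩
  omega

/-- Every column between `a` and `b` meets `A` or directly follows one that does. -/
theorem IsMinimal.width_le {A : Finset (ℤ × ℤ)} (hA : IsMinimal lattice (A : Set (ℤ × ℤ)))
    {a b : ℤ × ℤ} (ha : a ∈ A) (hb : b ∈ A) : b.1 - a.1 ≤ 2 * A.card := by
  set S := A.image Prod.fst with hS
  have hsub : Finset.Icc a.1 b.1 ⊆ S ∪ S.image (· + 1) := by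
    intro x hx
    rw [Finset.mem_Icc] at hx
    by_contra hxS
    rw [Finset.mem_union, not_or] at hxS
    have h1 : x ≠ a.1 := fun h => hxS.1 (h ▸ Finset.mem_image_of_mem _ ha)
    have h2 : x ≠ b.1 := fun h => hxS.1 (h ▸ Finset.mem_image_of_mem _ hb)
    have h3 : ∀ w ∈ A, w.1 + 1 ≠ x := fun w hw h =>
      hxS.2 (Finset.mem_image.2 ⟨w.1, Finset.mem_image_of_mem _ hw, h⟩)
    have h4 := h3 a ha
    obtain ⟨w, hw, h | h⟩ := hA.exists_column ha hb (m := x - 2) (by omega) (by omega)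
    · exact h3 w hw (by omega)
    · exact hxS.1 (Finset.mem_image.2 ⟨w, hw, by omega⟩)
  have h1 := (Finset.card_le_card hsub).trans (Finset.card_union_le _ _)
  have h2 : (S.image (· + 1)).card ≤ S.card := Finset.card_image_le
  have h3 : S.card ≤ A.card := Finset.card_image_le
  rw [Int.card_Icc] at h1
  omega

theorem IsMinimal.height_le {A : Finset (ℤ × ℤ)} (hA : IsMinimal lattice (A : Set (ℤ × ℤ)))
    {a b : ℤ × ℤ} (ha : a ∈ A) (hb : b ∈ A) : b.2 - a.2 ≤ 2 * A.card := by
  have h := (hA.of_congruent (congruent_image transposition A)).width_le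
    (Finset.mem_image_of_mem _ ha) (Finset.mem_image_of_mem _ hb)
  rw [Finset.card_image_of_injective _ transposition.injective] at h
  exact h

/-- The number of vertices of the sets in a class. -/
noncomputable def classSize : MinimalClass lattice → ℕ :=
  Quotient.lift (fun A => A.1.ncard) fun _ _ h => congrArg ENat.toNat (Congruent.encard_eq h)

theorem classSize_mk (A : Finset (ℤ × ℤ)) (h : IsMinimal lattice (A : Set (ℤ × ℤ))) :
    classSize (Quotient.mk (congruence lattice) ⟨A, h⟩) = A.card := Set.ncard_coe_finset A

theorem exists_finset_rep (v : MinimalClass lattice) :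
    ∃ (A : Finset (ℤ × ℤ)) (h : IsMinimal lattice (A : Set (ℤ × ℤ))),
      v = Quotient.mk (congruence lattice) ⟨A, h⟩ := by
  obtain ⟨⟨A, hA⟩, rfl⟩ := Quotient.exists_rep v
  obtain ⟨A, rfl⟩ := hA.finite.exists_finset_coe
  exact ⟨A, hA, rfl⟩

/-- Each class has a representative translated to have minimal coordinates 0, and the width and
height bounds confine it to a fixed square. -/
theorem finite_classSize_le (n : ℕ) : {v | classSize v ≤ n}.Finite := by
  set box : Finset (ℤ × ℤ) := Finset.Icc 0 (2 * n : ℤ) ×ˢ Finset.Icc 0 (2 * n : ℤ)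
  have hfin : {A : {A : Set (ℤ × ℤ) // IsMinimal lattice A} | A.1 ⊆ (box : Set (ℤ × ℤ))}.Finite :=
    box.finite_toSet.finite_subsets.preimage Subtype.val_injective.injOn
  refine (hfin.image (Quotient.mk (congruence lattice))).subset fun v hv => ?_
  obtain ⟨A, hA, rfl⟩ := exists_finset_rep v
  replace hv : A.card ≤ n := (classSize_mk A hA).symm.le.trans hv
  obtain ⟨a, ha, hamin⟩ := A.exists_min_image Prod.fst (by exact_mod_cast hA.nonempty)
  obtain ⟨b, hb, hbmin⟩ := A.exists_min_image Prod.snd (by exact_mod_cast hA.nonempty)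
  have hcong := congruent_image (translation (-a.1, -b.2)) A
  refine ⟨⟨_, hA.of_congruent hcong⟩, ?_, (Quotient.sound hcong).symm⟩
  intro p hp
  obtain ⟨q, hq, rfl⟩ := Finset.mem_image.1 (Finset.mem_coe.1 hp)
  rw [Finset.mem_coe, Finset.mem_product, Finset.mem_Icc, Finset.mem_Icc]
  change (0 ≤ q.1 + -a.1 ∧ q.1 + -a.1 ≤ 2 * n) ∧ (0 ≤ q.2 + -b.2 ∧ q.2 + -b.2 ≤ 2 * n)
  have h1 := hamin q hq
  have h2 := hbmin q hq
  have h3 := hA.width_le ha hq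
  have h4 := hA.height_le hb hq
  omega

/-! ### Infinite components -/

theorem classSize_adj {v w : MinimalClass lattice} (h : (minimalGraph lattice).Adj v w) :
    classSize w ≤ classSize v + 1 := by
  obtain ⟨⟨A, hA⟩, ⟨B, hB⟩, rfl, rfl, h⟩ := h
  obtain ⟨A, rfl⟩ := hA.finite.exists_finset_coe
  obtain ⟨B, rfl⟩ := hB.finite.exists_finset_coe
  rw [classSize_mk, classSize_mk]
  change (symmDiff (A : Set (ℤ × ℤ)) B).encard = 1 at h
  rw [← Finset.coe_symmDiff, Set.encard_coe_eq_coe_finsetCard, Nat.cast_eq_one] at h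
  have hsub : B ⊆ A ∪ symmDiff A B := by
    intro x hx
    rw [Finset.mem_union, Finset.mem_symmDiff]
    tauto
  have := (Finset.card_le_card hsub).trans (Finset.card_union_le _ _)
  omega

/-- A discrete intermediate value argument: size rises by at most one along each edge. -/
theorem exists_classSize_eq {v w : MinimalClass lattice} (p : (minimalGraph lattice).Walk v w)
    {m : ℕ} (hv : classSize v ≤ m) (hw : m ≤ classSize w) :
    ∃ u, (minimalGraph lattice).Reachable v u ∧ classSize u = m := by
  induction p with
  | nil => exact ⟨_, .refl _, le_antisymm hv hw⟩
  | @cons v x w hadj p ih =>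
    rcases hv.eq_or_lt with hv | hv
    · exact ⟨v, .refl _, hv⟩
    · have := classSize_adj hadj
      obtain ⟨u, hu, hum⟩ := ih (by omega) hw
      exact ⟨u, hadj.reachable.trans hu, hum⟩

theorem eventually_exists_mem_supp {C : (minimalGraph lattice).ConnectedComponent}
    (hC : C.supp.Infinite) : ∀ᶠ m in Filter.atTop, ∃ u ∈ C.supp, classSize u = m := by
  obtain ⟨v, hv⟩ := C.nonempty_supp
  filter_upwards [Filter.eventually_ge_atTop (classSize v)] with m hm
  obtain ⟨w, hw, hwm⟩ := hC.exists_notMem_finite (finite_classSize_le m)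
  obtain ⟨p⟩ := C.reachable_of_mem_supp hv hw
  obtain ⟨u, hu, hum⟩ := exists_classSize_eq p hm (not_le.1 hwm).le
  exact ⟨u, (SimpleGraph.ConnectedComponent.sound hu).symm.trans hv, hum⟩

theorem congruent_of_isDiagSquare {r : ℕ} {X Y : Finset (ℤ × ℤ)} {a b c d : ℤ}
    (hX : IsDiagSquare r a b X) (hXne : X.Nonempty) (hY : IsDiagSquare r c d Y)
    (hYne : Y.Nonempty) :
    Congruent lattice ((X ∪ nbr X : Finset (ℤ × ℤ)) : Set (ℤ × ℤ)) (Y ∪ nbr Y : Finset _) := by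
  obtain ⟨x, hx⟩ := hXne
  obtain ⟨y, hy⟩ := hYne
  obtain ⟨⟨i, hi, hi'⟩, j, hj, hj'⟩ := (hX x).1 hx
  obtain ⟨⟨k, hk, hk'⟩, l, hl, hl'⟩ := (hY y).1 hy
  -- The points `x` and `y` show that a, b have equal parity and c, d too, so the halves are exact.
  -- This is where nonemptiness matters.
  set t : ℤ × ℤ := ((c - a + (d - b)) / 2, (c - a - (d - b)) / 2) with ht
  have ht1 : t.1 + t.2 = c - a := by simp only [ht]; omega
  have ht2 : t.1 - t.2 = d - b := by simp only [ht]; omega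
  have hmem : ∀ p : ℤ × ℤ, p + t ∈ Y ↔ p ∈ X := by
    intro p
    rw [hX, hY]
    refine and_congr (exists_congr fun i => and_congr_right fun _ => ?_)
      (exists_congr fun i => and_congr_right fun _ => ?_) <;>
    · rw [Prod.fst_add, Prod.snd_add]
      omega
  refine ⟨translation t, ?_⟩
  ext w
  obtain ⟨w, rfl⟩ := (translation t).surjective w
  rw [(translation t).injective.mem_set_image, Finset.mem_coe, Finset.mem_coe, Finset.mem_union,
    Finset.mem_union, mem_nbr, mem_nbr]
  refine or_congr (hmem w).symm ⟨?_, ?_⟩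
  · rintro ⟨q, hq, h⟩
    exact ⟨translation t q, (hmem q).2 hq, (translation t).map_adj_iff.2 h⟩
  · rintro ⟨q, hq, h⟩
    obtain ⟨q, rfl⟩ := (translation t).surjective q
    exact ⟨q, (hmem q).1 hq, (translation t).map_adj_iff.1 h⟩

/-- There is only one class of minimal sets with the size of a ball. -/
theorem eq_of_classSize_eq_ball {r : ℕ} (hr : 1 ≤ r) {v w : MinimalClass lattice}
    (hv : classSize v = 2 * r ^ 2 + 2 * r + 1) (hw : classSize w = 2 * r ^ 2 + 2 * r + 1) :
    v = w := by
  have key : ∀ A : Finset (ℤ × ℤ), IsMinimal lattice (A : Set (ℤ × ℤ)) →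
      A.card = 2 * r ^ 2 + 2 * r + 1 →
      ∃ Y c d, Y.Nonempty ∧ IsDiagSquare r c d Y ∧ A = Y ∪ nbr Y := by
    intro A hA hcard
    -- The box with both sides 2r has the size of `A` and at most 4r + 4 boundary points; minimality
    -- passes this bound to `A`.
    have hbox := reachableBox_self (2 * r - 1)
    rw [show 2 * r - 1 + 1 = 2 * r by omega] at hbox
    have hball : (stair (2 * r) (2 * r) 0).card = A.card := by
      rw [hbox.card, hcard, show (2 * r + 1) * (2 * r + 1) + 1 = 2 * (2 * r ^ 2 + 2 * r + 1) by ring]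
      omega
    have hbd := ((isMinimal_coe_iff.1 hA).2 _ hball).trans hbox.card_bd
    obtain ⟨Y, c, d, hY, hAY⟩ := exists_eq_ball hr hcard (by omega)
    refine ⟨Y, c, d, Finset.nonempty_iff_ne_empty.2 ?_, hY, hAY⟩
    rintro rfl
    rw [hAY] at hcard
    simp [nbr] at hcard
  obtain ⟨A, hA, rfl⟩ := exists_finset_rep v
  obtain ⟨B, hB, rfl⟩ := exists_finset_rep w
  rw [classSize_mk] at hv hw
  obtain ⟨X, a, b, hXne, hX, rfl⟩ := key A hA hv
  obtain ⟨Y, c, d, hYne, hY, rfl⟩ := key B hB hw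
  exact Quotient.sound (congruent_of_isDiagSquare hX hXne hY hYne)

theorem infinite_supp_pairClass :
    ((minimalGraph lattice).connectedComponentMk pairClass).supp.Infinite := by
  refine Set.infinite_of_injective_forall_mem
    (f := fun k => Quotient.mk (congruence lattice) ⟨_, (reachableBox_self k).reachable.1⟩)
    (fun k l h => ?_) fun k =>
      (SimpleGraph.ConnectedComponent.sound (reachableBox_self k).reachable.2).symm
  have h1 := congrArg classSize h
  simp only [classSize_mk, (reachableBox_self k).card, (reachableBox_self l).card] at h1
  by_contra hne
  rcases lt_or_gt_of_ne hne with hlt | hlt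
  -- A gap of two survives the rounded halving in the size formula.
  · have : (k + 1 + 1) * (k + 1 + 1) + 2 ≤ (l + 1 + 1) * (l + 1 + 1) := by nlinarith
    omega
  · have : (l + 1 + 1) * (l + 1 + 1) + 2 ≤ (k + 1 + 1) * (k + 1 + 1) := by nlinarith
    omega

end MinimalSets

theorem mainTheorem8 :
    ∃! C : (MinimalSets.minimalGraph MinimalSets.lattice).ConnectedComponent,
      C.supp.Infinite := by
  refine ⟨_, MinimalSets.infinite_supp_pairClass, fun C hC => ?_⟩
  obtain ⟨n, hn⟩ := Filter.eventually_atTop.1 ((MinimalSets.eventually_exists_mem_supp hC).and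
    (MinimalSets.eventually_exists_mem_supp MinimalSets.infinite_supp_pairClass))
  -- Radius n + 1 is positive and makes the ball size exceed n, so both components contain the
  -- unique class of this size.
  obtain ⟨⟨u, hu, hun⟩, w, hw, hwn⟩ := hn (2 * (n + 1) ^ 2 + 2 * (n + 1) + 1) (by nlinarith)
  rw [← hu, ← hw, MinimalSets.eq_of_classSize_eq_ball (Nat.succ_pos n) hun hwn]
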